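/- Let $X$ be a reflexive real Banach space with topological dual $X^*$, let $C\subseteq X$ be nonempty, closed and convex, and let $F:C\times C\to\mathbb{R}$ satisfy $F(x,x)=0$ for all $x\in C$ and be monotone, i.e. $F(x,y)+F(y,x)\le 0$ for all $x,y\in C$. Suppose that for every $x\in C$ the function $F(x,\cdot)$ is convex and lower semicontinuous on $C$, and that for every $y\in C$ the function $F(\cdot,y)$ is upper hemicontinuous on $C$, i.e. upper semicontinuous on each line segment contained in $C$. Then $F$ is maximal monotone: the operator $A^F:X\rightrightarrows X^*$ given by $$A^F(x)=\{x^*\in X^*: F(x,y)-F(x,x)\ge\langle x^*,y-x\rangle\ \text{for all } y\in C\}\ \text{ if } x\in C,\qquad A^F(x)=\emptyset\ \text{ if } x\notin C,$$ is a maximal monotone operator, i.e. $\langle y^*-x^*,y-x\rangle\ge 0$ whenever $x^*\in A^F(x)$ and $y^*\in A^F(y)$, and the graph $\{(x,x^*): x^*\in A^F(x)\}$ is not properly included in the graph of any other operator $S:X\rightrightarrows X^*$ that is monotone in this sense. -/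

import Mathlib

namespace MonotoneBifunction

variable {X : Type*} [NormedAddCommGroup X] [NormedSpace ℝ X]

/-- A normed space is reflexive if the canonical injection into its bidual is onto. -/
def IsReflexive (X : Type*) [NormedAddCommGroup X] [NormedSpace ℝ X] : Prop :=
  Function.Surjective (NormedSpace.inclusionInDoubleDual ℝ X)

/-- The graph of a multifunction `T : X ⇉ X*`. -/
def graph (T : X → Set (StrongDual ℝ X)) : Set (X × StrongDual ℝ X) :=
  {p | p.2 ∈ T p.1}

/-- Monotone operators `T : X ⇉ X*`. -/
def IsMonotoneOperator (T : X → Set (StrongDual ℝ X)) : Prop :=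
  ∀ x y : X, ∀ xs ∈ T x, ∀ ys ∈ T y, 0 ≤ (ys - xs) (y - x)

/-- A monotone operator is maximal if its graph is not properly included in the graph of any
monotone operator. -/
def IsMaximalMonotoneOperator (T : X → Set (StrongDual ℝ X)) : Prop :=
  IsMonotoneOperator T ∧
    ∀ S : X → Set (StrongDual ℝ X), IsMonotoneOperator S → ¬ graph T ⊂ graph S

/-- A bifunction on `C` is represented by a map `F : X → X → ℝ` of which only the values on
`C × C` are ever used. It is monotone if `F x y + F y x ≤ 0` on `C`. -/
def IsMonotone (C : Set X) (F : X → X → ℝ) : Prop :=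
  ∀ x ∈ C, ∀ y ∈ C, F x y + F y x ≤ 0

/-- The operator `A^F : X ⇉ X*` attached to a bifunction `F` on `C`; it is empty outside `C`. -/
def assocOperator (C : Set X) (F : X → X → ℝ) (x : X) : Set (StrongDual ℝ X) :=
  {xs | x ∈ C ∧ ∀ y ∈ C, xs (y - x) ≤ F x y - F x x}

/-- A monotone bifunction `F` on `C` is maximal monotone if `A^F` is maximal monotone. -/
def IsMaximalMonotone (C : Set X) (F : X → X → ℝ) : Prop :=
  IsMonotone C F ∧ IsMaximalMonotoneOperator (assocOperator C F)

/-- Upper hemicontinuity on `C`: upper semicontinuity along each line segment in `C`. -/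
def UpperHemicontinuousOn (f : X → ℝ) (C : Set X) : Prop :=
  ∀ a b : X, segment ℝ a b ⊆ C → UpperSemicontinuousOn f (segment ℝ a b)

end MonotoneBifunction

namespace MonotoneBifunction

open Set Filter Topology

variable {X : Type*} [NormedAddCommGroup X] [NormedSpace ℝ X]

/-! Minty's resolvent argument. Given `(z, zs)`, perturb `F x y` by `G y - G x` with `G = ½‖· - z‖²
- zs`. `G` is coercive, so `exists_equilibrium` applies, and `exists_subgradient_of_isMin` splits
the equilibrium into `xs ∈ A^F x` and `zs - xs ∈ ∂(½‖· - z‖²)(x)`. If `(z, zs)` lies in a monotone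
extension of `A^F`, monotonicity and the subgradient inequality force `x = z` and then `xs = zs`, so
the extension is not proper. Equilibria come from the dual inequalities `H y x ≤ 0`: finitely many
are approximately solvable by separation in a finite-dimensional space, weak compactness solves all
of them, and Minty's lemma returns to `0 ≤ H x y`. -/

/-- In a reflexive space a family of closed convex sets, one of them bounded, with the finite
intersection property has a common point. -/
theorem IsReflexive.nonempty_iInter (hX : IsReflexive X) {ι : Type*} (K : ι → Set X)
    (hconv : ∀ i, Convex ℝ (K i)) (hclosed : ∀ i, IsClosed (K i)) (i₀ : ι)
    (hbdd : Bornology.IsBounded (K i₀))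
    (hfin : ∀ u : Finset ι, ∃ x, ∀ i ∈ u, x ∈ K i) : ∃ x, ∀ i, x ∈ K i := by
  classical
  let J : X → WeakDual ℝ (StrongDual ℝ X) := fun x =>
    StrongDual.toWeakDual (NormedSpace.inclusionInDoubleDual ℝ X x)
  have hJapp : ∀ x f, J x f = f x := fun _ _ => rfl
  have hJsurj : ∀ ψ, ∃ x, J x = ψ := fun ψ => by
    obtain ⟨x, hx⟩ := hX (WeakDual.toStrongDual ψ)
    exact ⟨x, by simp [J, hx]⟩
  have hJinj : Function.Injective J := fun x y hxy => by
    refine (SeparatingDual.eq_iff_forall_dual_eq (R := ℝ)).2 fun f => ?_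
    rw [← hJapp, ← hJapp, hxy]
  -- Evaluation at the separating functional is weak-* continuous, so the separating half-space is a
  -- weak-* neighbourhood missing `J '' K i`.
  have hJclosed : ∀ i, IsClosed (J '' K i) := fun i => by
    rw [← isOpen_compl_iff, isOpen_iff_mem_nhds]
    intro ψ hψ
    obtain ⟨x, rfl⟩ := hJsurj ψ
    have hx : x ∉ K i := fun h => hψ ⟨x, h, rfl⟩
    obtain ⟨f, u, hf, hu⟩ := geometric_hahn_banach_closed_point (hconv i) (hclosed i) hx
    have hopen : IsOpen {ψ : WeakDual ℝ (StrongDual ℝ X) | u < ψ f} :=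
      isOpen_lt continuous_const (WeakDual.eval_continuous f)
    refine Filter.mem_of_superset (hopen.mem_nhds (show u < J x f from hu)) ?_
    rintro _ hφ ⟨y, hy, rfl⟩
    exact lt_asymm (hf y hy) hφ
  have hcomp : IsCompact (J '' K i₀) := by
    obtain ⟨R, hR⟩ := hbdd.exists_norm_le
    refine (WeakDual.isCompact_closedBall (0 : StrongDual ℝ (StrongDual ℝ X)) R).of_isClosed_subset
      (hJclosed i₀) ?_
    rintro _ ⟨x, hx, rfl⟩
    simpa [J] using (NormedSpace.double_dual_bound ℝ X x).trans (hR x hx)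
  obtain ⟨ψ, -, hψ⟩ := hcomp.inter_iInter_nonempty (fun i => J '' K i) hJclosed fun u => by
    obtain ⟨x, hx⟩ := hfin (insert i₀ u)
    exact ⟨J x, ⟨x, hx _ (Finset.mem_insert_self _ _), rfl⟩, mem_iInter₂.2 fun i hi =>
      ⟨x, hx _ (Finset.mem_insert_of_mem hi), rfl⟩⟩
  obtain ⟨x, rfl⟩ := hJsurj ψ
  refine ⟨x, fun i => ?_⟩
  obtain ⟨y, hy, hyx⟩ := mem_iInter.1 hψ i
  rwa [← hJinj hyx]

/-! ### Equilibrium problems. -/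

/-- Finitely many of the inequalities `H y x ≤ 0` of the dual equilibrium problem can be solved
simultaneously up to any positive error. -/
theorem IsMonotone.exists_forall_lt {C : Set X} {H : X → X → ℝ} (hmono : IsMonotone C H)
    (hne : C.Nonempty) (hconv : ∀ x ∈ C, ConvexOn ℝ C (H x)) {ε : ℝ} (hε : 0 < ε)
    (s : Finset X) (hs : ∀ y ∈ s, y ∈ C) : ∃ x ∈ C, ∀ y ∈ s, H y x < ε := by
  classical
  obtain ⟨x₀, hx₀⟩ := hne
  have hC : Convex ℝ C := (hconv x₀ hx₀).1
  by_contra! hcon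
  -- `U` is open, convex and upward closed, and misses the constant `ε`. Upward closure makes the
  -- separating functional nonnegative; its normalized coefficients weight the points of `s` into a
  -- barycentre `xb` that contradicts monotonicity.
  let U : Set (s → ℝ) := {v | ∃ x ∈ C, ∀ i : s, H i x < v i}
  have hUopen : IsOpen U := by
    have : U = ⋃ x ∈ C, Set.pi univ fun i : s => Ioi (H i x) := by
      ext v; simp [U, Set.mem_pi]
    rw [this]
    exact isOpen_biUnion fun x _ => isOpen_set_pi finite_univ fun i _ => isOpen_Ioi
  have hUconv : Convex ℝ U := by
    rintro v ⟨x, hx, hv⟩ w ⟨y, hy, hw⟩ a b ha hb hab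
    refine ⟨a • x + b • y, hC hx hy ha hb hab, fun i => ?_⟩
    refine ((hconv i (hs i i.2)).2 hx hy ha hb hab).trans_lt ?_
    simp only [smul_eq_mul, Pi.add_apply, Pi.smul_apply]
    rcases ha.eq_or_lt with rfl | ha'
    · obtain rfl : b = 1 := by linarith
      simpa using hw i
    · nlinarith [mul_lt_mul_of_pos_left (hv i) ha', mul_le_mul_of_nonneg_left (hw i).le hb]
  have hεU : (fun _ => ε) ∉ U := by
    rintro ⟨x, hx, h⟩
    obtain ⟨y, hy, hle⟩ := hcon x hx
    exact absurd (h ⟨y, hy⟩) hle.not_gt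
  obtain ⟨f, hf⟩ := geometric_hahn_banach_point_open hUconv hUopen hεU
  let l : s → ℝ := fun i => f (Pi.single i 1)
  have hfl : ∀ v : s → ℝ, f v = ∑ i, v i * l i := fun v => by
    conv_lhs => rw [pi_eq_sum_univ' v]
    rw [map_sum]
    refine Finset.sum_congr rfl fun i _ => ?_
    rw [map_smul, smul_eq_mul]
  have hl : ∀ i, 0 ≤ l i := fun i => by
    by_contra! hneg
    let v : s → ℝ := fun j => H j x₀ + 1
    let t : ℝ := max 0 ((f v - f fun _ => ε) / (-l i))
    let e : s → ℝ := Pi.single i 1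
    have hmem : v + t • e ∈ U := ⟨x₀, hx₀, fun j => by
      have he : 0 ≤ (t • e) j := by
        simp only [e]
        rw [Pi.smul_apply, Pi.single_apply]
        split_ifs <;> simp [t]
      rw [Pi.add_apply]
      simp only [v]
      linarith⟩
    have h1 := hf _ hmem
    rw [map_add, map_smul, smul_eq_mul] at h1
    have h2 : (f v - f fun _ => ε) / (-l i) ≤ t := le_max_right _ _
    rw [div_le_iff₀ (by linarith)] at h2
    change _ < f v + t * l i at h1
    linarith
  have hsum : 0 < ∑ i, l i := by
    refine (Finset.sum_nonneg fun i _ => hl i).lt_of_ne fun h0 => ?_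
    have h0' : ∀ i, l i = 0 := fun i =>
      (Finset.sum_eq_zero_iff_of_nonneg fun i _ => hl i).1 h0.symm i (Finset.mem_univ i)
    have := hf (fun j => H j x₀ + 1) ⟨x₀, hx₀, fun j => by linarith⟩
    simp [hfl, h0'] at this
  set L := ∑ i, l i with hL
  let w : s → ℝ := fun i => l i / L
  have hw : ∀ i, 0 ≤ w i := fun i => div_nonneg (hl i) hsum.le
  have hw1 : ∑ i, w i = 1 := by
    rw [← Finset.sum_div, ← hL, div_self hsum.ne']
  have hlw : ∀ i, l i = L * w i := fun i => by
    simp only [w]; field_simp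
  set xb : X := ∑ i, w i • (i : X)
  have hxb : xb ∈ C := hC.sum_mem (fun i _ => hw i) hw1 fun i _ => hs i i.2
  have hpos : 0 < ∑ i : s, w i * H i xb := by
    have h := hf (fun j => H j xb + ε) ⟨xb, hxb, fun j => by linarith⟩
    have e : ∑ i : s, (H i xb + ε) * l i = L * ∑ i : s, w i * H i xb + ∑ i, ε * l i := by
      rw [Finset.mul_sum, ← Finset.sum_add_distrib]
      refine Finset.sum_congr rfl fun i _ => ?_
      rw [hlw i]; ring
    rw [hfl, hfl, e] at h
    exact pos_of_mul_pos_right (by linarith : 0 < L * _) hsum.le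
  have hjen : ∀ i : s, H i xb ≤ ∑ j : s, w j * H i j := fun i =>
    (hconv i (hs i i.2)).map_sum_le (t := Finset.univ) (p := fun j : s => (j : X))
      (fun j _ => hw j) hw1 fun j _ => hs j j.2
  have h1 : ∑ i : s, w i * H i xb ≤ ∑ i : s, ∑ j : s, w i * w j * H i j :=
    Finset.sum_le_sum fun i _ => by
      refine (mul_le_mul_of_nonneg_left (hjen i) (hw i)).trans_eq ?_
      rw [Finset.mul_sum]
      exact Finset.sum_congr rfl fun j _ => by ring
  -- Exchanging the indices pairs `H i j` with `H j i`.
  have h2 : ∑ i : s, ∑ j : s, w i * w j * H i j + ∑ i : s, ∑ j : s, w i * w j * H i j ≤ 0 := by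
    nth_rewrite 2 [Finset.sum_comm]
    rw [← Finset.sum_add_distrib]
    refine Finset.sum_nonpos fun i _ => ?_
    rw [← Finset.sum_add_distrib]
    refine Finset.sum_nonpos fun j _ => ?_
    have := mul_nonpos_of_nonneg_of_nonpos (mul_nonneg (hw i) (hw j))
      (hmono i (hs i i.2) j (hs j j.2))
    linarith
  linarith

/-- Minty's lemma: a solution of the dual equilibrium problem solves the primal one. -/
theorem nonneg_of_forall_nonpos {C : Set X} {H : X → X → ℝ} (h0 : ∀ x ∈ C, H x x = 0)
    (hconv : ∀ x ∈ C, ConvexOn ℝ C (H x))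
    (husc : ∀ y ∈ C, UpperHemicontinuousOn (fun x => H x y) C) {x : X} (hx : x ∈ C)
    (hdual : ∀ y ∈ C, H y x ≤ 0) {y : X} (hy : y ∈ C) : 0 ≤ H x y := by
  have hC : Convex ℝ C := (hconv x hx).1
  by_contra! hneg
  have hseg := hC.segment_subset hx hy
  have hev := husc y hy x y hseg x (left_mem_segment ℝ x y) 0 hneg
  -- Near `x` on the segment, `H (p t) y < 0` and `H (p t) x ≤ 0`, so convexity would give `H (p t)
  -- (p t) < 0`.
  let p : ℝ → X := fun t => (1 - t) • x + t • y
  have hp : Tendsto p (𝓝[>] 0) (𝓝[segment ℝ x y] x) := by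
    refine tendsto_nhdsWithin_iff.2 ⟨?_, ?_⟩
    · have : Continuous p := by fun_prop
      simpa [p] using (this.tendsto 0).mono_left nhdsWithin_le_nhds
    · filter_upwards [Ioo_mem_nhdsGT (zero_lt_one' ℝ)] with t ht
      exact ⟨1 - t, t, by linarith [ht.2], ht.1.le, by ring, rfl⟩
  obtain ⟨t, ht, ht01⟩ := ((hp.eventually hev).and (Ioo_mem_nhdsGT (zero_lt_one' ℝ))).exists
  have hpt : p t ∈ C := hC hx hy (by linarith [ht01.2]) ht01.1.le (by ring)
  have h := (hconv _ hpt).2 hx hy (by linarith [ht01.2] : 0 ≤ 1 - t) ht01.1.le (by ring)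
  change H (p t) (p t) ≤ _ at h
  rw [h0 _ hpt, smul_eq_mul, smul_eq_mul] at h
  have h3 := mul_nonpos_of_nonneg_of_nonpos (by linarith [ht01.2] : 0 ≤ 1 - t) (hdual _ hpt)
  have h4 := mul_neg_of_pos_of_neg ht01.1 ht
  linarith

/-- Existence for equilibrium problems in reflexive spaces: a monotone bifunction with one bounded
sublevel set has an equilibrium point. -/
theorem IsReflexive.exists_equilibrium (hX : IsReflexive X) {C : Set X} {H : X → X → ℝ}
    (hclosed : IsClosed C) (h0 : ∀ x ∈ C, H x x = 0) (hmono : IsMonotone C H)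
    (hconv : ∀ x ∈ C, ConvexOn ℝ C (H x)) (hlsc : ∀ x ∈ C, LowerSemicontinuousOn (H x) C)
    (husc : ∀ y ∈ C, UpperHemicontinuousOn (fun x => H x y) C) {y₀ : X} (hy₀ : y₀ ∈ C)
    (hbdd : Bornology.IsBounded {x | x ∈ C ∧ H y₀ x ≤ 1}) : ∃ x ∈ C, ∀ y ∈ C, 0 ≤ H x y := by
  classical
  -- The positive slack makes finite subfamilies solvable; the member for `y₀` with slack 1 is the
  -- bounded one.
  let K : C × Ioi (0 : ℝ) → Set X := fun i => {x | x ∈ C ∧ H i.1 x ≤ i.2}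
  obtain ⟨x, hx⟩ := hX.nonempty_iInter K (fun i => (hconv i.1 i.1.2).convex_le _)
    (fun i => by
      obtain ⟨v, hv, hvs⟩ := lowerSemicontinuousOn_iff_preimage_Iic.1 (hlsc i.1 i.1.2) i.2
      change IsClosed (C ∩ H i.1 ⁻¹' Iic (i.2 : ℝ))
      exact hvs ▸ hclosed.inter hv)
    (⟨y₀, hy₀⟩, ⟨1, mem_Ioi.2 one_pos⟩) hbdd fun u => by
      obtain ⟨ε, hε, hεu⟩ : ∃ ε : ℝ, 0 < ε ∧ ∀ i ∈ u, ε ≤ i.2 := by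
        induction u using Finset.induction_on with
        | empty => exact ⟨1, one_pos, by simp⟩
        | insert i u _ ih =>
          obtain ⟨ε, hε, h⟩ := ih
          refine ⟨min ε i.2, lt_min hε i.2.2, fun j hj => ?_⟩
          rcases Finset.mem_insert.1 hj with rfl | hj
          · exact min_le_right _ _
          · exact (min_le_left _ _).trans (h j hj)
      obtain ⟨x, hxC, hx⟩ := hmono.exists_forall_lt ⟨y₀, hy₀⟩ hconv hε
        (u.image fun i => (i.1 : X)) fun y hy => by
          obtain ⟨i, -, rfl⟩ := Finset.mem_image.1 hy
          exact i.1.2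
      exact ⟨x, fun i hi => ⟨hxC, (hx i.1 (Finset.mem_image_of_mem _ hi)).le.trans (hεu i hi)⟩⟩
  have hxC : x ∈ C := (hx (⟨y₀, hy₀⟩, ⟨1, mem_Ioi.2 one_pos⟩)).1
  refine ⟨x, hxC, fun y hy => nonneg_of_forall_nonpos h0 hconv husc hxC (fun y hy => ?_) hy⟩
  refine le_of_forall_pos_le_add fun ε hε => ?_
  simpa using (hx (⟨y, hy⟩, ⟨ε, hε⟩)).2

/-! ### Convex analysis. -/

/-- A convex function that is lower semicontinuous at a zero decreases at most linearly. -/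
theorem exists_linear_lower_bound {C : Set X} {h : X → ℝ} (hconv : ConvexOn ℝ C h) {x₀ : X}
    (hx₀ : x₀ ∈ C) (h0 : h x₀ = 0) (hlsc : LowerSemicontinuousOn h C) :
    ∃ b : ℝ, ∀ x ∈ C, -1 - b * ‖x - x₀‖ ≤ h x := by
  have hev := hlsc x₀ hx₀ (-1) (show -1 < h x₀ by rw [h0]; norm_num)
  obtain ⟨δ, hδ, hball⟩ := Metric.mem_nhdsWithin_iff.1 hev
  refine ⟨2 / δ, fun x hx => ?_⟩
  have hn := norm_nonneg (x - x₀)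
  by_cases hlt : ‖x - x₀‖ < δ
  · have : -1 < h x := hball ⟨by simpa [dist_eq_norm] using hlt, hx⟩
    have : 0 ≤ 2 / δ * ‖x - x₀‖ := by positivity
    linarith
  · push Not at hlt
    have hr : 0 < ‖x - x₀‖ := hδ.trans_le hlt
    -- `t` pulls `x` back to distance `δ / 2` from `x₀`, where `h > -1`.
    set t : ℝ := δ / 2 / ‖x - x₀‖ with ht
    have ht0 : 0 < t := by positivity
    have ht1 : t ≤ 1 := by rw [ht, div_le_one hr]; linarith
    have hmem : (1 - t) • x₀ + t • x ∈ C :=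
      hconv.1 hx₀ hx (by linarith) ht0.le (by ring)
    have hdist : (1 - t) • x₀ + t • x ∈ Metric.ball x₀ δ := by
      have : (1 - t) • x₀ + t • x - x₀ = t • (x - x₀) := by module
      rw [Metric.mem_ball, dist_eq_norm, this, norm_smul, Real.norm_of_nonneg ht0.le, ht,
        div_mul_cancel₀ _ hr.ne']
      linarith
    have h1 : -1 < h ((1 - t) • x₀ + t • x) := hball ⟨hdist, hmem⟩
    have h2 := hconv.2 hx₀ hx (by linarith : 0 ≤ 1 - t) ht0.le (by ring)
    rw [h0, smul_zero, zero_add, smul_eq_mul] at h2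
    have h3 : 2 / δ * ‖x - x₀‖ = 1 / t := by rw [ht]; field_simp
    have h4 : t * (1 / t) = 1 := by field_simp
    have h5 : -(1 / t) < h x := by
      by_contra! hc
      have := mul_le_mul_of_nonneg_left hc ht0.le
      linarith
    rw [h3]
    linarith

/-- Sandwich theorem: if `x` minimizes `h + G` over `C`, with `h` convex on `C` and `G` convex and
continuous, then some continuous linear functional is a subgradient of `h` at `x` while its
opposite is a subgradient of `G` at `x`. -/
theorem exists_subgradient_of_isMin {C : Set X} {h G : X → ℝ} (hconv : ConvexOn ℝ C h)
    (hG : ConvexOn ℝ univ G) (hGc : Continuous G) {x : X} (hx : x ∈ C)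
    (hmin : ∀ y ∈ C, h x + G x ≤ h y + G y) :
    ∃ f : StrongDual ℝ X, (∀ y ∈ C, f (y - x) ≤ h y - h x) ∧ ∀ y, G x - G y ≤ f (y - x) := by
  -- Separate the strict hypograph of `h x + G x - G` from the epigraph of `h`; both boundaries pass
  -- through `(x, h x)`.
  let U : Set (X × ℝ) := {p | p.2 + G p.1 < h x + G x}
  let E : Set (X × ℝ) := {p | p.1 ∈ C ∧ h p.1 ≤ p.2}
  have hUopen : IsOpen U := isOpen_lt (by fun_prop) continuous_const
  have hUconv : Convex ℝ U := by
    rintro p hp q hq a b ha hb hab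
    have hGpq := hG.2 (mem_univ p.1) (mem_univ q.1) ha hb hab
    simp only [smul_eq_mul] at hGpq
    simp only [U, mem_ofPred_eq] at hp hq
    change a * p.2 + b * q.2 + G (a • p.1 + b • q.1) < h x + G x
    obtain rfl : b = 1 - a := by linarith
    rcases ha.eq_or_lt with rfl | ha'
    · simpa using hq
    · nlinarith [mul_lt_mul_of_pos_left hp ha', mul_le_mul_of_nonneg_left hq.le hb]
  have hdisj : Disjoint U E := Set.disjoint_left.2 fun p hpU hpE => by
    have := hmin p.1 hpE.1
    have : p.2 + G p.1 < h x + G x := hpU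
    linarith [hpE.2]
  obtain ⟨φ, s, hφU, hφE⟩ := geometric_hahn_banach_open hUconv hUopen hconv.convex_epigraph hdisj
  let g : StrongDual ℝ X := φ.comp (ContinuousLinearMap.inl ℝ X ℝ)
  let c : ℝ := φ (0, 1)
  have hφ : ∀ y t, φ (y, t) = g y + t * c := fun y t => by
    have : ((y, t) : X × ℝ) = (y, 0) + t • (0, 1) := by simp
    rw [this, map_add, map_smul]; rfl
  have hs1 : s ≤ g x + h x * c := hφ x (h x) ▸ hφE (x, h x) ⟨hx, le_rfl⟩
  have hU : ∀ y, ∀ ε > 0, g y + (h x + G x - G y - ε) * c < s := fun y ε hε =>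
    hφ y _ ▸ hφU (y, h x + G x - G y - ε) (by simp only [U, mem_ofPred_eq]; linarith)
  have hc : 0 < c := by
    have := hU x 1 one_pos
    nlinarith
  have hU' : ∀ y, g y + (h x + G x - G y) * c ≤ s := fun y => by
    refine le_of_forall_pos_le_add fun ε hε => ?_
    have := hU y (ε / c) (div_pos hε hc)
    rw [sub_mul, div_mul_cancel₀ _ hc.ne'] at this
    linarith
  have hs2 : g x + h x * c ≤ s := by simpa using hU' x
  refine ⟨-(c⁻¹ • g), fun y hy => ?_, fun y => ?_⟩
  · have h1 : s ≤ g y + h y * c := hφ y (h y) ▸ hφE (y, h y) ⟨hy, le_rfl⟩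
    have h2 : (-(c⁻¹ • g)) (y - x) = (g x - g y) / c := by
      simp [div_eq_inv_mul]; ring
    rw [h2, div_le_iff₀ hc]
    linarith
  · have h1 := hU' y
    have h2 : (-(c⁻¹ • g)) (y - x) = (g x - g y) / c := by
      simp [div_eq_inv_mul]; ring
    rw [h2, le_div_iff₀ hc]
    linarith

/-- A continuous linear functional minorized by `-½‖·‖²` vanishes. -/
theorem eq_zero_of_neg_sq_le {f : StrongDual ℝ X} (hf : ∀ v, -(‖v‖ ^ 2 / 2) ≤ f v) : f = 0 := by
  have key : ∀ v, 0 ≤ f v := fun v => by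
    refine le_of_forall_pos_le_add fun ε hε => ?_
    -- Dividing the bound at `t • v` by `t` leaves the error `t * ‖v‖ ^ 2 / 2`, which this `t` keeps
    -- below `ε`.
    let t : ℝ := ε / (‖v‖ ^ 2 + 1)
    have ht : 0 < t := by positivity
    have h := hf (t • v)
    rw [norm_smul, Real.norm_of_nonneg ht.le, map_smul, smul_eq_mul] at h
    have h1 : t * (‖v‖ ^ 2 + 1) = ε := by simp only [t]; field_simp
    have h2 : 0 ≤ t * (f v + t * ‖v‖ ^ 2 / 2) := by linarith
    have h3 := nonneg_of_mul_nonneg_right h2 ht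
    nlinarith [sq_nonneg ‖v‖]
  ext v
  have := key (-v)
  rw [map_neg] at this
  exact le_antisymm (by simpa using this) (key v)

/-! ### The operator `A^F` and its resolvent equation. -/

theorem IsMonotone.isMonotoneOperator_assocOperator {C : Set X} {F : X → X → ℝ}
    (hF0 : ∀ x ∈ C, F x x = 0) (hF : IsMonotone C F) :
    IsMonotoneOperator (assocOperator C F) := by
  rintro x y xs ⟨hx, hxs⟩ ys ⟨hy, hys⟩
  have h1 := hxs y hy
  have h2 := hys x hx
  have h3 := hF x hx y hy
  rw [hF0 x hx] at h1
  rw [hF0 y hy, ← neg_sub y x, map_neg] at h2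
  rw [sub_apply]
  linarith

theorem convexOn_half_norm_sub_sq_sub (z : X) (zs : StrongDual ℝ X) :
    ConvexOn ℝ univ fun y => ‖y - z‖ ^ 2 / 2 - zs y := by
  refine ⟨convex_univ, fun x _ y _ a b ha hb hab => ?_⟩
  have h1 : ‖a • x + b • y - z‖ ≤ a * ‖x - z‖ + b * ‖y - z‖ := by
    have : a • x + b • y - z = a • (x - z) + b • (y - z) := by
      obtain rfl : b = 1 - a := by linarith
      module
    rw [this]
    refine (norm_add_le _ _).trans_eq ?_
    rw [norm_smul, norm_smul, Real.norm_of_nonneg ha, Real.norm_of_nonneg hb]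
  have h2 : ‖a • x + b • y - z‖ ^ 2 ≤ (a * ‖x - z‖ + b * ‖y - z‖) ^ 2 := by gcongr
  simp only [map_add, map_smul, smul_eq_mul]
  obtain rfl : b = 1 - a := by linarith
  nlinarith [mul_nonneg (mul_nonneg ha hb) (sq_nonneg (‖x - z‖ - ‖y - z‖))]

/-- The resolvent equation for `A^F`: some point of the graph of `A^F` solves the inclusion
`zs ∈ xs + ∂(½‖· - z‖²)(x)`. -/
theorem IsReflexive.exists_mem_assocOperator (hX : IsReflexive X) {C : Set X} (hCne : C.Nonempty)
    (hCclosed : IsClosed C) {F : X → X → ℝ} (hF0 : ∀ x ∈ C, F x x = 0) (hFmono : IsMonotone C F)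
    (hFconv : ∀ x ∈ C, ConvexOn ℝ C (F x)) (hFlsc : ∀ x ∈ C, LowerSemicontinuousOn (F x) C)
    (hFusc : ∀ y ∈ C, UpperHemicontinuousOn (fun x => F x y) C) (z : X) (zs : StrongDual ℝ X) :
    ∃ x, ∃ xs ∈ assocOperator C F x,
      ∀ y, ‖x - z‖ ^ 2 / 2 - ‖y - z‖ ^ 2 / 2 ≤ (xs - zs) (y - x) := by
  obtain ⟨y₀, hy₀⟩ := hCne
  let G : X → ℝ := fun y => ‖y - z‖ ^ 2 / 2 - zs y
  have hGc : Continuous G := by fun_prop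
  have hG : ConvexOn ℝ univ G := convexOn_half_norm_sub_sq_sub z zs
  obtain ⟨x, hx, hmin⟩ := hX.exists_equilibrium (H := fun x y => F x y + (G y - G x)) hCclosed
    (fun x hx => by simp [hF0 x hx])
    (fun x hx y hy => by linarith [hFmono x hx y hy])
    (fun x hx => (hFconv x hx).add
      (((hG.subset (subset_univ _) (hFconv x hx).1).add_const (-G x)).congr fun y _ => rfl))
    (fun x hx => by
      have hc : Continuous fun y => G y - G x := by fun_prop
      exact (hFlsc x hx).add (hc.lowerSemicontinuous.lowerSemicontinuousOn C))
    (fun y hy a b hab => by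
      have hc : Continuous fun x => G y - G x := by fun_prop
      exact (hFusc y hy a b hab).add (hc.upperSemicontinuous.upperSemicontinuousOn _))
    hy₀ (by
      obtain ⟨b, hb⟩ := exists_linear_lower_bound (hFconv y₀ hy₀) hy₀ (hF0 y₀ hy₀) (hFlsc y₀ hy₀)
      -- With `r = ‖x - z‖`, the sublevel condition becomes `r ^ 2 / 2 ≤ B * r + A`, which fails
      -- once `r > 2 * B + A ^ 2 + 2`.
      let R : ℝ := 2 * (|b| + ‖zs‖) + (1 + (1 + |b| * ‖z - y₀‖) + G y₀ + zs z) ^ 2 + 2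
      refine (Metric.isBounded_closedBall (x := z) (r := R)).subset fun x hx => ?_
      obtain ⟨hxC, hle⟩ := hx
      rw [Metric.mem_closedBall, dist_eq_norm]
      have h1 := hb x hxC
      have h2 : ‖x - y₀‖ ≤ ‖x - z‖ + ‖z - y₀‖ := norm_sub_le_norm_sub_add_norm_sub x z y₀
      have h3 : b * ‖x - y₀‖ ≤ |b| * (‖x - z‖ + ‖z - y₀‖) :=
        mul_le_mul (le_abs_self b) h2 (norm_nonneg _) (abs_nonneg _)
      have h4 : zs x - zs z ≤ ‖zs‖ * ‖x - z‖ := by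
        rw [← map_sub]; exact (le_abs_self _).trans (zs.le_opNorm _)
      have h5 : ‖x - z‖ ^ 2 / 2 ≤
          (|b| + ‖zs‖) * ‖x - z‖ + (1 + (1 + |b| * ‖z - y₀‖) + G y₀ + zs z) := by
        have : G x = ‖x - z‖ ^ 2 / 2 - zs x := rfl
        linarith
      have hB : 0 ≤ |b| + ‖zs‖ := by positivity
      simp only [R]
      generalize |b| + ‖zs‖ = B at h5 hB ⊢
      generalize 1 + (1 + |b| * ‖z - y₀‖) + G y₀ + zs z = A at h5 ⊢
      by_contra! hc
      nlinarith [sq_nonneg (A - 1), sq_nonneg A, norm_nonneg (x - z)])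
  obtain ⟨f, hfC, hfG⟩ := exists_subgradient_of_isMin (hFconv x hx) hG hGc hx fun y hy => by
    have : 0 ≤ F x y + (G y - G x) := hmin y hy
    rw [hF0 x hx]
    linarith
  refine ⟨x, f, ⟨hx, hfC⟩, fun y => ?_⟩
  have := hfG y
  simp only [G] at this
  rw [sub_apply, map_sub zs]
  linarith

end MonotoneBifunction

open MonotoneBifunction in
theorem mainTheorem7 {X : Type*} [NormedAddCommGroup X] [NormedSpace ℝ X] [CompleteSpace X]
    (hX : MonotoneBifunction.IsReflexive X)
    (C : Set X) (hCne : C.Nonempty) (hCconv : Convex ℝ C) (hCclosed : IsClosed C)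
    (F : X → X → ℝ)
    (hF0 : ∀ x ∈ C, F x x = 0)
    (hFmono : MonotoneBifunction.IsMonotone C F)
    (hFconv : ∀ x ∈ C, ConvexOn ℝ C (fun y => F x y))
    (hFlsc : ∀ x ∈ C, LowerSemicontinuousOn (fun y => F x y) C)
    (hFusc : ∀ y ∈ C, MonotoneBifunction.UpperHemicontinuousOn (fun x => F x y) C) :
    MonotoneBifunction.IsMaximalMonotone C F := by
  refine ⟨hFmono, hFmono.isMonotoneOperator_assocOperator hF0, fun S hS hlt => ?_⟩
  obtain ⟨hsub, hnot⟩ := hlt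
  refine hnot fun ⟨z, zs⟩ hz => ?_
  obtain ⟨x, xs, hxs, hres⟩ :=
    hX.exists_mem_assocOperator hCne hCclosed hF0 hFmono hFconv hFlsc hFusc z zs
  have hmon : 0 ≤ (xs - zs) (x - z) := hS z x zs hz xs (hsub (a := (x, xs)) hxs)
  -- At `y = z` the resolvent inequality bounds `‖x - z‖ ^ 2 / 2` by `-(xs - zs) (x - z)`, which is
  -- nonpositive by `hmon`.
  have h1 := hres z
  rw [← neg_sub x z, map_neg, sub_self, norm_zero] at h1
  have hxz : x = z := by
    have : ‖x - z‖ ^ 2 ≤ 0 := by linarith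
    exact sub_eq_zero.1 (norm_eq_zero.1 (pow_eq_zero_iff two_ne_zero |>.1
      (le_antisymm this (sq_nonneg _))))
  subst hxz
  have h2 : xs - zs = 0 := eq_zero_of_neg_sq_le fun v => by
    simpa using hres (x + v)
  rw [sub_eq_zero] at h2
  exact h2 ▸ hxs
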